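/- Let $G=(\mathrm{C}_6\times \mathrm{C}_2)\rtimes \mathrm{C}_2=\langle a,b,c\mid a^6=b^2=c^2=1,\ ba=ab,\ cac=a^{-1},\ cbc=a^3b\rangle$, a group of order $24$, and let $K$ be a field that contains an element of multiplicative order $12$. For a finite dimensional $KG$-module $V$, let $K[V]^G$ be the algebra of $G$-invariants in the polynomial ring $K[V]=K[x_1,\dots,x_n]$ on $V$ ($n=\dim V$). Let $\beta(G,V)$ be the minimal positive integer $d$ such that the $K$-algebra $K[V]^G$ is generated by elements of degree at most $d$. Let $\beta_{\mathrm{sep}}(G,V)$ be the minimal positive integer $d$ such that for all $v,w\in V$ with $G\cdot v\neq G\cdot w$ there is an $f\in K[V]^G$ of degree at most $d$ with $f(v)\ne f(w)$. Let $\beta^K(G)$ (the Noether number) and $\beta^K_{\mathrm{sep}}(G)$ (the separating Noether number) be the suprema of $\beta(G,V)$ and of $\beta_{\mathrm{sep}}(G,V)$, respectively, as $V$ ranges over all finite dimensional $KG$-modules. Then $$\beta^K_{\mathrm{sep}}(G)=9=\beta^K(G).$$ -/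

import Mathlib

noncomputable section

namespace InvariantTheory

section Numbers

variable {K G : Type*} [Field K] [Group G] {n : ℕ}

/-- The action of `g` on `K[V] = K[x₁, …, xₙ]` for a `KG`-module `V = Kⁿ`: the `K`-algebra
endomorphism with `g • x_j = ∑ i, (ρ g⁻¹)_{j i} x_i`, i.e. `f ↦ f ∘ ρ(g⁻¹)`. -/
def polyAct (ρ : Representation K G (Fin n → K)) (g : G) :
    MvPolynomial (Fin n) K →ₐ[K] MvPolynomial (Fin n) K :=
  MvPolynomial.aeval fun j =>
    ∑ i, MvPolynomial.C (LinearMap.toMatrix' (ρ g⁻¹) j i) * MvPolynomial.X i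

/-- The algebra `K[V]^G` of invariant polynomials. -/
def invariantAlgebra (ρ : Representation K G (Fin n → K)) :
    Subalgebra K (MvPolynomial (Fin n) K) :=
  ⨅ g : G, AlgHom.equalizer (polyAct ρ g) (AlgHom.id K _)

/-- The `G`-invariants of degree at most `d`. -/
def invariantsLE (ρ : Representation K G (Fin n → K)) (d : ℕ) :
    Set (MvPolynomial (Fin n) K) :=
  {f | f ∈ invariantAlgebra ρ ∧ f.totalDegree ≤ d}

/-- The orbit `G · v`. -/
def orbit (ρ : Representation K G (Fin n → K)) (v : Fin n → K) : Set (Fin n → K) :=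
  Set.range fun g : G => ρ g v

/-- `S` separates any two points of `V` that lie in different orbits. -/
def IsSeparating (ρ : Representation K G (Fin n → K)) (S : Set (MvPolynomial (Fin n) K)) :
    Prop :=
  ∀ v w : Fin n → K, orbit ρ v ≠ orbit ρ w →
    ∃ f ∈ S, MvPolynomial.eval v f ≠ MvPolynomial.eval w f

/-- `β(G, V)`: the minimal positive integer `d` such that `K[V]^G` is generated as a `K`-algebra
by elements of degree at most `d` (`⊤` if there is none). -/
def noetherNumberOf (ρ : Representation K G (Fin n → K)) : ℕ∞ :=
  ⨅ (d : ℕ) (_ : 0 < d ∧ Algebra.adjoin K (invariantsLE ρ d) = invariantAlgebra ρ), (d : ℕ∞)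

/-- `β_sep(G, V)`: the minimal positive integer `d` such that the invariants of degree at most `d`
form a separating set (`⊤` if there is none). -/
def sepNoetherNumberOf (ρ : Representation K G (Fin n → K)) : ℕ∞ :=
  ⨅ (d : ℕ) (_ : 0 < d ∧ IsSeparating ρ (invariantsLE ρ d)), (d : ℕ∞)

variable (K G)

/-- The Noether number `β^K(G)`: the supremum of `β(G, V)` over all finite dimensional
`KG`-modules `V` (each of which is isomorphic to some `Kⁿ` with a linear `G`-action). -/
def noetherNumber : ℕ∞ :=
  ⨆ (n : ℕ) (ρ : Representation K G (Fin n → K)), noetherNumberOf ρ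

/-- The separating Noether number `β_sep^K(G)`: the supremum of `β_sep(G, V)` over all finite
dimensional `KG`-modules `V`. -/
def sepNoetherNumber : ℕ∞ :=
  ⨆ (n : ℕ) (ρ : Representation K G (Fin n → K)), sepNoetherNumberOf ρ

end Numbers

end InvariantTheory

/-! The group `(C₆ × C₂) ⋊ C₂`. -/

/-- The cyclic group of order `m`, written multiplicatively. -/
abbrev Cyc (m : ℕ) : Type := Multiplicative (ZMod m)

/-- The involutive automorphism `a ↦ a⁻¹`, `b ↦ a³b` of `C₆ × C₂ = ⟨a⟩ × ⟨b⟩`,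
i.e. `aⁱbʲ ↦ a⁻ⁱ⁺³ʲbʲ`. -/
def gammaAut : MulAut (Cyc 6 × Cyc 2) where
  toFun x := (x.1⁻¹ * Multiplicative.ofAdd (3 : ZMod 6) ^ (Multiplicative.toAdd x.2).val, x.2)
  invFun x := (x.1⁻¹ * Multiplicative.ofAdd (3 : ZMod 6) ^ (Multiplicative.toAdd x.2).val, x.2)
  left_inv := by decide
  right_inv := by decide
  map_mul' := by decide

/-- `C₂` acts on `C₆ × C₂` with its generator acting as `gammaAut`. -/
def gammaHom : Cyc 2 →* MulAut (Cyc 6 × Cyc 2) where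
  toFun s := gammaAut ^ (Multiplicative.toAdd s).val
  map_one' := by simp
  map_mul' := by
    have h : gammaAut ^ 2 = 1 := by
      ext1 x
      revert x
      exact gammaAut.left_inv
    have h01 : ∀ s : ZMod 2, s = 0 ∨ s = 1 := by decide
    intro s t
    rcases h01 (Multiplicative.toAdd s) with hs | hs <;>
      rcases h01 (Multiplicative.toAdd t) with ht | ht <;>
      simp [hs, ht, toAdd_mul, ZMod.val_one, show (1 + 1 : ZMod 2) = 0 from rfl, ← pow_two, h]

/-- The group `(C₆ × C₂) ⋊ C₂ = ⟨a, b, c ∣ a⁶ = b² = c² = 1, ba = ab, cac = a⁻¹, cbc = a³b⟩`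
of order 24. -/
abbrev C6C2C2 : Type := (Cyc 6 × Cyc 2) ⋊[gammaHom] Cyc 2

end

/-! Upper bound. Since 24 is invertible in `K`, every invariant is a multiple of its orbit sum, and
since `⟨a, b⟩` acts diagonalizably it suffices to treat products of linear weight vectors. Weights
live in `ZMod 3` (for `a²`) and in the Klein four-group (for `a³` and `b`); unless both total
weights vanish, the orbit sum is zero. In degree at least 10 the Klein weights split into at least
five zero-sum parts (`Multiset.exists_zeroSum_partition`), and these regroup into four factors of
`ZMod 3`-weights `β, -β, β, -β` (`ZMod.exists_fourPartition`). As `c` negates such weights, a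
polarization identity expresses the orbit sum through invariants of lower degree
(`orbitSum_prod_five_mem`), so degree 9 suffices to generate. Invariants of a finite group separate
its orbits, so `β_sep ≤ 9` follows.

Lower bound. On the sum of a faithful two-dimensional module and a suitable one-dimensional one,
invariants of degree at most 8 agree at `(1, y, 1)` and `(1, y, -1)`, whereas `x₀x₁x₂(x₀⁶ - x₁⁶)` is
an invariant of degree 9 that distinguishes them when `y⁶ = -1`. This pair of points bounds both
numbers from below. -/

namespace InvariantTheory

open MvPolynomial

/-! ### Orbit sums and separation of orbits for finite groups. -/

section General

variable {K G : Type*} [Field K] [Group G] {n : ℕ} (ρ : Representation K G (Fin n → K))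

theorem eval_polyAct (g : G) (v : Fin n → K) (f : MvPolynomial (Fin n) K) :
    eval v (polyAct ρ g f) = eval (ρ g⁻¹ v) f := by
  have h : (aeval v).comp (polyAct ρ g) = aeval (R := K) (ρ g⁻¹ v) := by
    apply MvPolynomial.algHom_ext
    intro j
    have := congrFun (LinearMap.toMatrix'_mulVec (ρ g⁻¹) v) j
    simp [polyAct, ← this, Matrix.mulVec, dotProduct]
  have := DFunLike.congr_fun h f
  simpa [aeval_eq_eval] using this

theorem polyAct_mul (g h : G) : polyAct ρ (g * h) = (polyAct ρ g).comp (polyAct ρ h) := by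
  apply MvPolynomial.algHom_ext
  intro j
  simp only [polyAct, aeval_X, AlgHom.comp_apply, map_sum, map_mul, mul_inv_rev,
    LinearMap.toMatrix'_mul, Matrix.mul_apply, algHom_C, algebraMap_eq, Finset.sum_mul,
    Finset.mul_sum]
  rw [Finset.sum_comm]
  simp only [mul_assoc]

theorem polyAct_mul_apply (g h : G) (f : MvPolynomial (Fin n) K) :
    polyAct ρ (g * h) f = polyAct ρ g (polyAct ρ h f) := by
  rw [polyAct_mul]; rfl

theorem polyAct_one : polyAct ρ 1 = AlgHom.id K _ := by
  apply MvPolynomial.algHom_ext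
  intro j
  simp [polyAct, Pi.single_apply, apply_ite C, ite_mul]

theorem polyAct_isHomogeneous (g : G) {f : MvPolynomial (Fin n) K} {d : ℕ}
    (hf : f.IsHomogeneous d) : (polyAct ρ g f).IsHomogeneous d := by
  have := hf.aeval (S := K) (τ := Fin n) (n := 1)
    (fun j => ∑ i, MvPolynomial.C (LinearMap.toMatrix' (ρ g⁻¹) j i) * MvPolynomial.X i)
    (fun j => IsHomogeneous.sum _ _ _ fun i _ => by
      simpa using (isHomogeneous_C (Fin n) (LinearMap.toMatrix' (ρ g⁻¹) j i)).mul
        (isHomogeneous_X K i))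
  simpa [polyAct] using this

theorem mem_invariantAlgebra {f : MvPolynomial (Fin n) K} :
    f ∈ invariantAlgebra ρ ↔ ∀ g, polyAct ρ g f = f := by
  simp [invariantAlgebra, Algebra.mem_iInf, AlgHom.mem_equalizer]

theorem adjoin_invariantsLE_le (d : ℕ) :
    Algebra.adjoin K (invariantsLE ρ d) ≤ invariantAlgebra ρ :=
  Algebra.adjoin_le fun _ hf => hf.1

theorem eval_eq_of_mem_adjoin {S : Set (MvPolynomial (Fin n) K)} {v w : Fin n → K}
    (h : ∀ f ∈ S, eval v f = eval w f) {f : MvPolynomial (Fin n) K}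
    (hf : f ∈ Algebra.adjoin K S) : eval v f = eval w f := by
  have hle : Algebra.adjoin K S ≤ AlgHom.equalizer (aeval v) (aeval (R := K) w) :=
    Algebra.adjoin_le fun f hf => by simpa [AlgHom.mem_equalizer, aeval_eq_eval] using h f hf
  simpa [AlgHom.mem_equalizer, aeval_eq_eval] using hle hf

variable [Fintype G]

/-- The sum of the translates of a polynomial under the group. -/
noncomputable def orbitSum : MvPolynomial (Fin n) K →ₗ[K] MvPolynomial (Fin n) K :=
  ∑ g : G, (polyAct ρ g).toLinearMap

theorem orbitSum_apply (f : MvPolynomial (Fin n) K) :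
    orbitSum ρ f = ∑ g : G, polyAct ρ g f := by
  simp [orbitSum]

theorem orbitSum_polyAct (g : G) (f : MvPolynomial (Fin n) K) :
    orbitSum ρ (polyAct ρ g f) = orbitSum ρ f := by
  simp only [orbitSum_apply, ← polyAct_mul_apply]
  exact Fintype.sum_equiv (Equiv.mulRight g) _ _ fun _ => rfl

theorem orbitSum_mem (f : MvPolynomial (Fin n) K) : orbitSum ρ f ∈ invariantAlgebra ρ := by
  rw [mem_invariantAlgebra]
  intro g
  simp only [orbitSum_apply, map_sum, ← polyAct_mul_apply]
  exact Fintype.sum_equiv (Equiv.mulLeft g) _ _ fun _ => rfl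

theorem orbitSum_of_mem {f : MvPolynomial (Fin n) K} (hf : f ∈ invariantAlgebra ρ) :
    orbitSum ρ f = (Fintype.card G : K) • f := by
  rw [mem_invariantAlgebra] at hf
  simp [orbitSum_apply, hf, Nat.cast_smul_eq_nsmul]

theorem orbitSum_isHomogeneous {f : MvPolynomial (Fin n) K} {d : ℕ} (hf : f.IsHomogeneous d) :
    (orbitSum ρ f).IsHomogeneous d := by
  rw [orbitSum_apply]
  exact IsHomogeneous.sum _ _ _ fun g _ => polyAct_isHomogeneous ρ g hf

/-- An eigenvector of a group element with eigenvalue different from `1` has orbit sum zero. -/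
theorem orbitSum_eq_zero (g : G) {f : MvPolynomial (Fin n) K} {l : K}
    (hf : polyAct ρ g f = l • f) (hl : l ≠ 1) : orbitSum ρ f = 0 := by
  have h := orbitSum_polyAct ρ g f
  rw [hf, map_smul] at h
  have h2 : (l - 1) • orbitSum ρ f = 0 := by rw [sub_smul, h, one_smul, sub_self]
  exact (smul_eq_zero.mp h2).resolve_left (sub_ne_zero.mpr hl)

/-- A polynomial that takes the value `1` at `v` and vanishes at all other points of a finite
set. -/
theorem exists_eval_indicator (S : Finset (Fin n → K)) (v : Fin n → K) :
    ∃ f : MvPolynomial (Fin n) K, eval v f = 1 ∧ ∀ u ∈ S, u ≠ v → eval u f = 0 := by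
  classical
  induction S using Finset.induction_on with
  | empty => exact ⟨1, by simp⟩
  | insert w S _ ih =>
    obtain ⟨f, hf, hS⟩ := ih
    by_cases hwv : w = v
    · refine ⟨f, hf, fun u hu huv => hS u ?_ huv⟩
      rcases Finset.mem_insert.mp hu with rfl | h
      · exact absurd hwv huv
      · exact h
    · obtain ⟨j, hj⟩ := Function.ne_iff.mp hwv
      have hj' : v j - w j ≠ 0 := sub_ne_zero.mpr (Ne.symm hj)
      refine ⟨f * (C (v j - w j)⁻¹ * (X j - C (w j))), by simp [hf, hj'], fun u hu huv => ?_⟩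
      rcases Finset.mem_insert.mp hu with rfl | h
      · simp
      · simp [hS u h huv]

theorem exists_eval_indicator_finset (S T : Finset (Fin n → K)) (hST : Disjoint S T) :
    ∃ f : MvPolynomial (Fin n) K, (∀ v ∈ S, eval v f = 1) ∧ ∀ u ∈ T, eval u f = 0 := by
  classical
  choose f hf hf' using exists_eval_indicator (K := K) (S ∪ T)
  refine ⟨∑ v ∈ S, f v, fun v hv => ?_, fun u hu => ?_⟩
  · rw [map_sum, Finset.sum_eq_single v (fun w _ hwv => hf' w v (by simp [hv]) hwv.symm)
      (fun h => absurd hv h), hf]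
  · rw [map_sum]
    refine Finset.sum_eq_zero fun v hv => hf' v u (by simp [hu]) ?_
    rintro rfl
    exact Finset.disjoint_left.mp hST hv hu

/-- The invariants of a finite group separate its orbits. -/
theorem isSeparating_invariantAlgebra : IsSeparating ρ (invariantAlgebra ρ) := by
  classical
  intro v w hvw
  have hdisj : Disjoint (Finset.univ.image fun g : G => ρ g v)
      (Finset.univ.image fun g : G => ρ g w) := by
    rw [Finset.disjoint_left]
    intro u hu hu'
    obtain ⟨g, -, rfl⟩ := Finset.mem_image.mp hu
    obtain ⟨h, -, hh⟩ := Finset.mem_image.mp hu'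
    apply hvw
    ext x
    constructor
    · rintro ⟨k, rfl⟩
      refine ⟨k * g⁻¹ * h, ?_⟩
      have := congrArg (ρ (k * g⁻¹)) hh
      simpa [← Module.End.mul_apply, ← map_mul] using this
    · rintro ⟨k, rfl⟩
      refine ⟨k * h⁻¹ * g, ?_⟩
      have := congrArg (ρ (k * h⁻¹)) hh.symm
      simpa [← Module.End.mul_apply, ← map_mul] using this
  obtain ⟨f, hf1, hf0⟩ := exists_eval_indicator_finset _ _ hdisj
  -- The product of the translates is 1 at `v` and 0 at `w`. A sum of translates would give `|G|` at
  -- `v`, which may vanish in `K`.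
  refine ⟨∏ g : G, polyAct ρ g f, ?_, ?_⟩
  · rw [SetLike.mem_coe, mem_invariantAlgebra]
    intro g
    simp only [map_prod, ← polyAct_mul_apply]
    exact Fintype.prod_equiv (Equiv.mulLeft g) _ _ fun _ => rfl
  · rw [map_prod, map_prod]
    simp only [eval_polyAct]
    rw [Finset.prod_eq_one fun g _ => hf1 _ (by simp),
      Finset.prod_eq_zero (Finset.mem_univ (1 : G))
        (hf0 _ (Finset.mem_image_of_mem _ (Finset.mem_univ _)))]
    exact one_ne_zero

theorem isSeparating_of_adjoin_eq {d : ℕ}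
    (h : Algebra.adjoin K (invariantsLE ρ d) = invariantAlgebra ρ) :
    IsSeparating ρ (invariantsLE ρ d) := by
  intro v w hvw
  by_contra! hcon
  obtain ⟨f, hf, hne⟩ := isSeparating_invariantAlgebra ρ v w hvw
  rw [← h] at hf
  exact hne (eval_eq_of_mem_adjoin hcon hf)

end General

end InvariantTheory

/-! ### Zero-sum combinatorics over the Klein four-group and `ZMod 3`. -/

/-- A zero-sum multiset over the Klein four-group, of cardinality `N`, splits into at least
`(N - 1) / 2` nonempty zero-sum parts. -/
theorem Multiset.exists_zeroSum_partition {ι : Type*} (k : ι → ZMod 2 × ZMod 2) (s : Multiset ι)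
    (hs : (s.map k).sum = 0) :
    ∃ P : Multiset (Multiset ι), P.sum = s ∧ (∀ p ∈ P, p ≠ 0 ∧ (p.map k).sum = 0) ∧
      Multiset.card s ≤ 2 * Multiset.card P + 1 := by
  induction hn : Multiset.card s using Nat.strong_induction_on generalizing s with
  | _ N ih =>
  by_cases h0 : s = 0
  · subst h0
    exact ⟨0, by simp, by simp, by simp [← hn]⟩
  -- splitting off a zero-sum part with one or two elements
  have step : ∀ p q : Multiset ι, s = p + q → p ≠ 0 → (p.map k).sum = 0 →
      Multiset.card p ≤ 2 → ∃ P : Multiset (Multiset ι), P.sum = s ∧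
        (∀ p ∈ P, p ≠ 0 ∧ (p.map k).sum = 0) ∧ N ≤ 2 * Multiset.card P + 1 := by
    rintro p q rfl hp hpk hpc
    have hp' := Multiset.card_pos.mpr hp
    rw [Multiset.card_add] at hn
    obtain ⟨P, hP, hP', hc⟩ := ih (Multiset.card q) (by omega) q
      (by simpa [hpk] using hs) rfl
    refine ⟨p ::ₘ P, by simp [hP], ?_, by rw [Multiset.card_cons]; omega⟩
    intro r hr
    rcases Multiset.mem_cons.mp hr with rfl | hr
    · exact ⟨hp, hpk⟩
    · exact hP' r hr
  by_cases hz : ∃ x ∈ s, k x = 0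
  · obtain ⟨x, hx, hkx⟩ := hz
    obtain ⟨q, rfl⟩ := Multiset.exists_cons_of_mem hx
    exact step {x} q (by simp) (by simp) (by simp [hkx]) (by simp)
  -- Distinct nonzero values number at most three, so `s` itself is one admissible part; a repeated
  -- value gives a zero-sum pair to split off.
  by_cases hd : (s.map k).Nodup
  · refine ⟨{s}, by simp, by simp [h0, hs], ?_⟩
    have hle : s.map k ≤ (Finset.univ.erase (0 : ZMod 2 × ZMod 2)).val := by
      rw [Multiset.le_iff_subset hd]
      intro y hy
      obtain ⟨x, hx, rfl⟩ := Multiset.mem_map.mp hy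
      have : k x ≠ 0 := fun h => hz ⟨x, hx, h⟩
      exact Finset.mem_erase.mpr ⟨this, Finset.mem_univ _⟩
    have := Multiset.card_le_card hle
    have h3 : Multiset.card (Finset.univ.erase (0 : ZMod 2 × ZMod 2)).val = 3 := by decide
    rw [h3, Multiset.card_map, hn] at this
    simpa using this
  · rw [Multiset.nodup_iff_ne_cons_cons] at hd
    push Not at hd
    obtain ⟨y, t, ht⟩ := hd
    obtain ⟨x, hx, rfl⟩ := Multiset.mem_map.mp (show y ∈ s.map k by simp [ht])
    obtain ⟨q, rfl⟩ := Multiset.exists_cons_of_mem hx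
    rw [Multiset.map_cons, Multiset.cons_inj_right] at ht
    obtain ⟨x', hx', hkx⟩ := Multiset.mem_map.mp (show k x ∈ q.map k by simp [ht])
    obtain ⟨q', rfl⟩ := Multiset.exists_cons_of_mem hx'
    refine step {x, x'} q' (by simp) (by simp) ?_ (by simp)
    have : ∀ a : ZMod 2 × ZMod 2, a + a = 0 := by decide
    simp [hkx, this]

/-- Five elements of `ZMod 3` of sum zero can be distributed over four classes, at most one of
them empty, with sums `b, -b, b, -b`. -/
theorem ZMod.exists_fourPartition : ∀ t : Fin 5 → ZMod 3, ∑ i, t i = 0 → ∃ c : Fin 5 → Fin 4,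
  ∃ b : ZMod 3, (∀ k : Fin 4, ∑ i with c i = k, t i = if k = 0 ∨ k = 2 then b else -b) ∧
   ∀ k l : Fin 4, k ≠ l → ∃ i, c i = k ∨ c i = l := by
  -- An empty class cannot be excluded: `1, 1, 1, 0, 0` forces `b = 0`, with the three ones
  -- together.
  decide +kernel

/-! ### Weight vectors for the abelian subgroup of index two. -/

namespace InvariantTheory

open MvPolynomial

instance : Fintype C6C2C2 := Fintype.ofEquiv _ SemidirectProduct.equivProd.symm

theorem card_C6C2C2 : Fintype.card C6C2C2 = 24 := by
  rw [Fintype.card_congr SemidirectProduct.equivProd]; decide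

/-- The element `a²`. -/
abbrev elA2 : C6C2C2 := SemidirectProduct.inl (Multiplicative.ofAdd 2, 1)

/-- The element `a³`. -/
abbrev elA3 : C6C2C2 := SemidirectProduct.inl (Multiplicative.ofAdd 3, 1)

/-- The element `b`. -/
abbrev elB : C6C2C2 := SemidirectProduct.inl (1, Multiplicative.ofAdd 1)

/-- The element `c`. -/
abbrev elC : C6C2C2 := SemidirectProduct.inr (Multiplicative.ofAdd 1)

theorem pow_val_add {M : Type*} [Monoid M] {m : ℕ} [NeZero m] {z : M} (hz : z ^ m = 1)
    (x y : ZMod m) : z ^ (x + y).val = z ^ x.val * z ^ y.val := by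
  rw [ZMod.val_add, ← pow_eq_pow_mod _ hz, pow_add]

/-- An operator of order three projects onto its eigenspaces. -/
theorem map_cubic_eigenvector {K V : Type*} [Field K] [AddCommGroup V] [Module K V]
    (T : V →ₗ[K] V) {f : V} (hT : T (T (T f)) = f) {u : K} (hu : u ^ 3 = 1) :
    T (f + u ^ 2 • T f + u • T (T f)) = u • (f + u ^ 2 • T f + u • T (T f)) := by
  simp only [map_add, map_smul, hT, smul_add, smul_smul]
  rw [show u * u ^ 2 = 1 by rw [← hu]; ring, show u * u = u ^ 2 by ring, one_smul]
  abel

/-- The three eigenprojections add up to `3f`, because `1 + w + w²` and `1 + w² + w⁴` vanish. -/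
theorem cubic_eigenvector_sum {K V : Type*} [Field K] [AddCommGroup V] [Module K V] {w : K}
    (hw : w ^ 3 = 1) (hsum : 1 + w + w ^ 2 = 0) (h3 : (3 : K) ≠ 0) (f g h : V) :
    f = (3 : K)⁻¹ • ((f + (1 : K) ^ 2 • g + (1 : K) • h) + (f + w ^ 2 • g + w • h) +
      (f + (w ^ 2) ^ 2 • g + w ^ 2 • h)) := by
  rw [eq_inv_smul_iff₀ h3]
  match_scalars
  · norm_num
  · linear_combination -hsum - w * hw
  · linear_combination -hsum

section Weights

variable {K : Type*} [Field K] {n : ℕ} (ρ : Representation K C6C2C2 (Fin n → K)) (w : K)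

/-- `f` is a weight vector for the subgroup `⟨a, b⟩ = ⟨a²⟩ × ⟨a³⟩ × ⟨b⟩`, where `w` is a primitive
cube root of unity. -/
structure IsWeight (t : ZMod 3) (k : ZMod 2 × ZMod 2) (f : MvPolynomial (Fin n) K) : Prop where
  a2 : polyAct ρ elA2 f = w ^ t.val • f
  a3 : polyAct ρ elA3 f = (-1 : K) ^ k.1.val • f
  b : polyAct ρ elB f = (-1 : K) ^ k.2.val • f

variable {ρ w}

theorem IsWeight.one : IsWeight ρ w 0 0 1 := ⟨by simp, by simp, by simp⟩

theorem IsWeight.mul (hw : w ^ 3 = 1) {t t' : ZMod 3} {k k' : ZMod 2 × ZMod 2}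
    {f f' : MvPolynomial (Fin n) K} (h : IsWeight ρ w t k f) (h' : IsWeight ρ w t' k' f') :
    IsWeight ρ w (t + t') (k + k') (f * f') := by
  have h2 : (-1 : K) ^ 2 = 1 := by norm_num
  exact ⟨by rw [map_mul, h.a2, h'.a2, smul_mul_smul_comm, pow_val_add hw],
    by rw [map_mul, h.a3, h'.a3, smul_mul_smul_comm, Prod.fst_add, pow_val_add h2],
    by rw [map_mul, h.b, h'.b, smul_mul_smul_comm, Prod.snd_add, pow_val_add h2]⟩

theorem IsWeight.multiset_prod (hw : w ^ 3 = 1) {ι : Type*} {t : ι → ZMod 3}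
    {k : ι → ZMod 2 × ZMod 2} {f : ι → MvPolynomial (Fin n) K}
    (h : ∀ i, IsWeight ρ w (t i) (k i) (f i)) (s : Multiset ι) :
    IsWeight ρ w (s.map t).sum (s.map k).sum (s.map f).prod := by
  induction s using Multiset.induction_on with
  | empty => simpa using IsWeight.one
  | cons i s ih => simpa using (h i).mul hw ih

/-- Conjugation by `c` inverts `a²`, whence the sign of `t`. It sends `b` to `a³b`, so it can change
a Klein weight but fixes the weight 0. -/
theorem IsWeight.polyAct_elC (hw : w ^ 3 = 1) {t : ZMod 3} {f : MvPolynomial (Fin n) K}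
    (h : IsWeight ρ w t 0 f) : IsWeight ρ w (-t) 0 (polyAct ρ elC f) := by
  have ha3 : polyAct ρ elA3 f = f := by simpa using h.a3
  have hb : polyAct ρ elB f = f := by simpa using h.b
  refine ⟨?_, ?_, ?_⟩
  · rw [← polyAct_mul_apply, show elA2 * elC = elC * (elA2 * elA2)
      by decide, polyAct_mul_apply, polyAct_mul_apply, h.a2, map_smul, h.a2, map_smul, map_smul,
      smul_smul, ← pow_val_add hw]
    rw [show t + t = -t from (by decide : ∀ t : ZMod 3, t + t = -t) t]
  · rw [← polyAct_mul_apply, show elA3 * elC = elC * elA3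
      by decide, polyAct_mul_apply, ha3]
    simp
  · rw [← polyAct_mul_apply, show elB * elC = elC * (elA3 * elB)
      by decide, polyAct_mul_apply, polyAct_mul_apply, hb, ha3]
    simp

theorem IsWeight.polyAct_inl {f : MvPolynomial (Fin n) K} (h : IsWeight ρ w 0 0 f)
    (x : Cyc 6 × Cyc 2) : polyAct ρ (SemidirectProduct.inl x) f = f := by
  have ha2 : polyAct ρ elA2 f = f := by simpa using h.a2
  have ha3 : polyAct ρ elA3 f = f := by simpa using h.a3
  have hb : polyAct ρ elB f = f := by simpa using h.b
  have hgen : ∀ x : Cyc 6 × Cyc 2, ∃ i j k : Fin 3,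
      (SemidirectProduct.inl x : C6C2C2) = elA2 ^ (i : ℕ) * elA3 ^ (j : ℕ) * elB ^ (k : ℕ) := by
    decide +kernel
  have hpow : ∀ (g : C6C2C2) (i : ℕ), polyAct ρ g f = f → polyAct ρ (g ^ i) f = f := by
    intro g i hg
    induction i with
    | zero => simp [polyAct_one]
    | succ i ih => rw [pow_succ, polyAct_mul_apply, hg, ih]
  obtain ⟨i, j, k, hx⟩ := hgen x
  rw [hx, polyAct_mul_apply, polyAct_mul_apply, hpow _ _ hb, hpow _ _ ha3, hpow _ _ ha2]

/-- Both `f` and its image under `c` are fixed by `⟨a, b⟩`, so each of the two cosets contributes 12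
equal terms. -/
theorem IsWeight.orbitSum_eq (hw : w ^ 3 = 1) {f : MvPolynomial (Fin n) K}
    (h : IsWeight ρ w 0 0 f) :
    orbitSum ρ f = (12 : K) • (f + polyAct ρ elC f) := by
  have h' : IsWeight ρ w 0 0 (polyAct ρ elC f) := by simpa using h.polyAct_elC hw
  rw [orbitSum_apply, Fintype.sum_equiv SemidirectProduct.equivProd _
    (fun p : (Cyc 6 × Cyc 2) × Cyc 2 => polyAct ρ (SemidirectProduct.inr p.2) f)]
  · rw [Fintype.sum_prod_type]
    dsimp only
    rw [Finset.sum_const]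
    have hu : (Finset.univ : Finset (Cyc 2)) = {1, Multiplicative.ofAdd 1} := by decide
    have hc : (Finset.univ : Finset (Cyc 6 × Cyc 2)).card = 12 := by decide
    rw [hu, Finset.sum_pair (by decide), hc, map_one, polyAct_one, ← Nat.cast_smul_eq_nsmul K]
    rfl
  · intro g
    conv_lhs => rw [← SemidirectProduct.inl_left_mul_inr_right g, polyAct_mul_apply]
    have hs : ∀ s : Cyc 2, s = 1 ∨ s = Multiplicative.ofAdd 1 := by decide
    change _ = polyAct ρ (SemidirectProduct.inr g.right) f
    rcases hs g.right with hg | hg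
    · rw [hg, map_one, polyAct_one]
      exact h.polyAct_inl _
    · rw [hg]
      exact h'.polyAct_inl _

theorem IsWeight.orbitSum_eq_zero (hw : IsPrimitiveRoot w 3) (h2 : (2 : K) ≠ 0) {t : ZMod 3}
    {k : ZMod 2 × ZMod 2} {f : MvPolynomial (Fin n) K} (h : IsWeight ρ w t k f)
    (htk : ¬(t = 0 ∧ k = 0)) : orbitSum ρ f = 0 := by
  have hz : ∀ x : ZMod 2, x ≠ 0 → (-1 : K) ^ x.val ≠ 1 := by
    intro x hx
    have : x = 1 := by revert x; decide
    rw [this, ZMod.val_one, pow_one]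
    intro h
    apply h2
    linear_combination -h
  by_cases ht : t = 0
  · by_cases h1 : k.1 = 0
    · have hk2 : k.2 ≠ 0 := fun hk => htk ⟨ht, Prod.ext h1 hk⟩
      exact InvariantTheory.orbitSum_eq_zero ρ _ h.b (hz _ hk2)
    · exact InvariantTheory.orbitSum_eq_zero ρ _ h.a3 (hz _ h1)
  · refine InvariantTheory.orbitSum_eq_zero ρ _ h.a2 (hw.pow_ne_one_of_pos_of_lt ?_ t.val_lt)
    rwa [Ne, ZMod.val_eq_zero]

/-- Linear forms are sums of linear weight vectors. -/
theorem homogeneousSubmodule_one_le_span_isWeight (hw : IsPrimitiveRoot w 3) (h2 : (2 : K) ≠ 0)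
    (h3 : (3 : K) ≠ 0) : homogeneousSubmodule (Fin n) K 1 ≤
      Submodule.span K {f | f.IsHomogeneous 1 ∧ ∃ t k, IsWeight ρ w t k f} := by
  have hw3 := hw.pow_eq_one
  have hsum : 1 + w + w ^ 2 = 0 := by
    have := hw.geom_sum_eq_zero (by norm_num)
    simpa [Finset.sum_range_succ] using this
  set S := Submodule.span K {f | f.IsHomogeneous 1 ∧ ∃ t k, IsWeight ρ w t k f} with hS
  -- the eigenvectors of `a³` and `b`
  have key : ∀ (f : MvPolynomial (Fin n) K) (k : ZMod 2 × ZMod 2), f.IsHomogeneous 1 →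
      polyAct ρ elA3 f = (-1 : K) ^ k.1.val • f → polyAct ρ elB f = (-1 : K) ^ k.2.val • f →
      f ∈ S := by
    intro f k hf hf3 hfb
    have hf1 := polyAct_isHomogeneous ρ elA2 hf
    have hf2 := polyAct_isHomogeneous ρ elA2 hf1
    have hcyc : polyAct ρ elA2 (polyAct ρ elA2 (polyAct ρ elA2 f)) = f := by
      rw [← polyAct_mul_apply, ← polyAct_mul_apply, show elA2 * elA2 * elA2 = 1 by decide,
        polyAct_one]; rfl
    have comm3 : ∀ f, polyAct ρ elA3 (polyAct ρ elA2 f) = polyAct ρ elA2 (polyAct ρ elA3 f) := by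
      intro f
      rw [← polyAct_mul_apply, ← polyAct_mul_apply, show elA3 * elA2 = elA2 * elA3 by decide]
    have commb : ∀ f, polyAct ρ elB (polyAct ρ elA2 f) = polyAct ρ elA2 (polyAct ρ elB f) := by
      intro f
      rw [← polyAct_mul_apply, ← polyAct_mul_apply, show elB * elA2 = elA2 * elB by decide]
    have comp : ∀ (t : ZMod 3) (u : K), u = w ^ t.val →
        f + u ^ 2 • polyAct ρ elA2 f + u • polyAct ρ elA2 (polyAct ρ elA2 f) ∈ S := by
      intro t u hu
      have hu3 : u ^ 3 = 1 := by rw [hu, ← pow_mul, mul_comm, pow_mul, hw3, one_pow]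
      refine Submodule.subset_span ⟨?_, t, k, ⟨?_, ?_, ?_⟩⟩
      · exact (homogeneousSubmodule (Fin n) K 1).add_mem
          ((homogeneousSubmodule (Fin n) K 1).add_mem hf (Submodule.smul_mem _ _ hf1))
          (Submodule.smul_mem _ _ hf2)
      · rw [← hu]
        exact map_cubic_eigenvector (polyAct ρ elA2).toLinearMap hcyc hu3
      · rw [map_add, map_add, map_smul, map_smul, comm3, comm3, comm3, hf3, map_smul, map_smul,
          smul_add, smul_add, smul_comm (u ^ 2), smul_comm u]
      · rw [map_add, map_add, map_smul, map_smul, commb, commb, commb, hfb, map_smul, map_smul,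
          smul_add, smul_add, smul_comm (u ^ 2), smul_comm u]
    have h0 := comp 0 1 (by simp)
    have h1 := comp 1 w (by simp [ZMod.val_one])
    have h2 := comp 2 (w ^ 2) (by rw [show (2 : ZMod 3).val = 2 from rfl])
    rw [cubic_eigenvector_sum hw3 hsum h3 f (polyAct ρ elA2 f) (polyAct ρ elA2 (polyAct ρ elA2 f))]
    exact S.smul_mem _ (S.add_mem (S.add_mem h0 h1) h2)
  have split : ∀ (g : C6C2C2) (f : MvPolynomial (Fin n) K),
      f = (2 : K)⁻¹ • (f + polyAct ρ g f) + (2 : K)⁻¹ • (f - polyAct ρ g f) := by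
    intro g f
    rw [← smul_add, eq_inv_smul_iff₀ h2, two_smul]
    abel
  have hab : ∀ f, polyAct ρ elA3 (polyAct ρ elB f) = polyAct ρ elB (polyAct ρ elA3 f) := by
    intro f
    rw [← polyAct_mul_apply, ← polyAct_mul_apply, show elA3 * elB = elB * elA3 by decide]
  have ha3 : ∀ f, polyAct ρ elA3 (polyAct ρ elA3 f) = f := by
    intro f
    rw [← polyAct_mul_apply, show elA3 * elA3 = 1 by decide, polyAct_one]; rfl
  have hbb : ∀ f, polyAct ρ elB (polyAct ρ elB f) = f := by
    intro f
    rw [← polyAct_mul_apply, show elB * elB = 1 by decide, polyAct_one]; rfl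
  have key2 : ∀ (f : MvPolynomial (Fin n) K) (k : ZMod 2), f.IsHomogeneous 1 →
      polyAct ρ elA3 f = (-1 : K) ^ k.val • f → f ∈ S := by
    intro f k hf hf3
    have hf1 := polyAct_isHomogeneous ρ elB hf
    rw [split elB f]
    refine S.add_mem (S.smul_mem _ (key _ (k, 0) (hf.add hf1) ?_ ?_))
      (S.smul_mem _ (key _ (k, 1) (hf.sub hf1) ?_ ?_))
    · simp only [map_add, hab, hf3, map_smul, smul_add]
    · simp only [map_add, hbb, ZMod.val_zero, pow_zero, one_smul, add_comm]
    · simp only [map_sub, hab, hf3, map_smul, smul_sub]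
    · simp only [map_sub, hbb, ZMod.val_one, pow_one, neg_smul, one_smul, neg_sub]
  intro f hf
  rw [mem_homogeneousSubmodule] at hf
  have hf1 := polyAct_isHomogeneous ρ elA3 hf
  rw [split elA3 f]
  refine S.add_mem (S.smul_mem _ (key2 _ 0 (hf.add hf1) ?_))
    (S.smul_mem _ (key2 _ 1 (hf.sub hf1) ?_))
  · simp only [map_add, ha3, ZMod.val_zero, pow_zero, one_smul, add_comm]
  · simp only [map_sub, ha3, ZMod.val_one, pow_one, neg_smul, one_smul, neg_sub]

end Weights

end InvariantTheory

/-! ### Upper bound: orbit sums of degree at least ten are decomposable. -/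

namespace InvariantTheory

open MvPolynomial
open scoped Pointwise

section UpperBound

variable {K : Type*} [Field K] {n : ℕ} {ρ : Representation K C6C2C2 (Fin n → K)} {w : K}

/-- A product of five forms of positive degree and of weights in `ZMod 3` has an orbit sum that is
decomposable, if its weight is zero. -/
theorem orbitSum_prod_five_mem (hw : w ^ 3 = 1) (h2 : (2 : K) ≠ 0) (h12 : (12 : K) ≠ 0)
    {B : Subalgebra K (MvPolynomial (Fin n) K)} {d : ℕ}
    (hB : ∀ e < d, ∀ f : MvPolynomial (Fin n) K, f.IsHomogeneous e → orbitSum ρ f ∈ B)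
    {f : Fin 5 → MvPolynomial (Fin n) K} {e : Fin 5 → ℕ} {t : Fin 5 → ZMod 3}
    (hf : ∀ i, (f i).IsHomogeneous (e i)) (he : ∀ i, 0 < e i) (hed : ∑ i, e i = d)
    (hft : ∀ i, IsWeight ρ w (t i) 0 (f i)) (ht : ∑ i, t i = 0) :
    orbitSum ρ (∏ i, f i) ∈ B := by
  classical
  obtain ⟨c, β, hsum, hne⟩ := ZMod.exists_fourPartition t ht
  set F : Fin 4 → MvPolynomial (Fin n) K := fun k => ∏ i with c i = k, f i with hF
  set D : Fin 4 → ℕ := fun k => ∑ i with c i = k, e i with hD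
  have hprod : ∏ i, f i = F 0 * F 1 * F 2 * F 3 := by
    rw [← Finset.prod_fiberwise Finset.univ c f, Fin.prod_univ_four]
  have hDsum : D 0 + D 1 + D 2 + D 3 = d := by
    rw [← hed, ← Finset.sum_fiberwise Finset.univ c e, Fin.sum_univ_four]
  have hFD : ∀ k, (F k).IsHomogeneous (D k) := fun k =>
    IsHomogeneous.prod _ _ _ fun i _ => hf i
  have hFw : ∀ k, IsWeight ρ w (if k = 0 ∨ k = 2 then β else -β) 0 (F k) := by
    intro k
    rw [← hsum k]
    have : ∀ s : Finset (Fin 5), IsWeight ρ w (∑ i ∈ s, t i) 0 (∏ i ∈ s, f i) := by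
      intro s
      induction s using Finset.induction_on with
      | empty => simpa using IsWeight.one
      | insert i s hi ih =>
        rw [Finset.sum_insert hi, Finset.prod_insert hi]
        simpa using (hft i).mul hw ih
    exact this _
  have hDpos : ∀ k l, k ≠ l → 0 < D k + D l := by
    intro k l hkl
    obtain ⟨i, hi⟩ := hne k l hkl
    rcases hi with hi | hi
    · exact Nat.add_pos_left ((he i).trans_le
        (Finset.single_le_sum (f := e) (fun _ _ => Nat.zero_le _) (by simp [hi]))) _
    · exact Nat.add_pos_right _ ((he i).trans_le
        (Finset.single_le_sum (f := e) (fun _ _ => Nat.zero_le _) (by simp [hi])))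
  have hw0 : IsWeight ρ w β 0 (F 0) := hFw 0
  have hw1 : IsWeight ρ w (-β) 0 (F 1) := hFw 1
  have hw2 : IsWeight ρ w β 0 (F 2) := hFw 2
  have hw3 : IsWeight ρ w (-β) 0 (F 3) := hFw 3
  have hw2' := hw2.polyAct_elC hw
  have hw3' := hw3.polyAct_elC hw
  rw [neg_neg] at hw3'
  -- Two factors of opposite weight multiply to an `⟨a, b⟩`-invariant, so the sum of their product
  -- with its `c`-image is 1/12 of an orbit sum of lower degree.
  have tau : ∀ {a b : MvPolynomial (Fin n) K} {x y : ℕ} {s : ZMod 3}, a.IsHomogeneous x →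
      b.IsHomogeneous y → IsWeight ρ w s 0 a → IsWeight ρ w (-s) 0 b → x + y < d →
      a * b + polyAct ρ elC a * polyAct ρ elC b ∈ B := by
    intro a b x y s ha hb hwa hwb hlt
    have hab : IsWeight ρ w 0 0 (a * b) := by simpa using hwa.mul hw hwb
    have := B.smul_mem (hB _ hlt _ (ha.mul hb)) (12 : K)⁻¹
    rwa [hab.orbitSum_eq hw, smul_smul, inv_mul_cancel₀ h12, one_smul, map_mul] at this
  have hcc : ∀ f, polyAct ρ elC (polyAct ρ elC f) = f := by
    intro f
    rw [← polyAct_mul_apply, show elC * elC = 1 by decide, polyAct_one]; rfl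
  -- At most one class is empty, so any two have positive total degree and the complementary two
  -- have degree below `d`.
  have p01 := hDpos 0 1 (by decide)
  have p03 := hDpos 0 3 (by decide)
  have p02 := hDpos 0 2 (by decide)
  have p12 := hDpos 1 2 (by decide)
  have p13 := hDpos 1 3 (by decide)
  have p23 := hDpos 2 3 (by decide)
  have m01 := tau (hFD 0) (hFD 1) hw0 hw1 (by omega)
  have m23 := tau (hFD 2) (hFD 3) hw2 hw3 (by omega)
  have m03 := tau (hFD 0) (hFD 3) hw0 hw3 (by omega)
  have m21 := tau (hFD 2) (hFD 1) hw2 hw1 (by omega)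
  have m02 := tau (hFD 0) (polyAct_isHomogeneous ρ elC (hFD 2)) hw0 hw2' (by omega)
  have m31 := tau (polyAct_isHomogeneous ρ elC (hFD 3)) (hFD 1) hw3' hw1 (by omega)
  have hall : IsWeight ρ w 0 0 (F 0 * F 1 * F 2 * F 3) := by
    simpa using ((hw0.mul hw hw1).mul hw hw2).mul hw hw3
  -- With `'` for the action of `c`, the identity is `2(F₀F₁F₂F₃ + F₀'F₁'F₂'F₃') = (F₀F₁ +
  -- F₀'F₁')(F₂F₃ + F₂'F₃') + (F₀F₃ + F₀'F₃')(F₂F₁ + F₂'F₁') - (F₀F₂' + F₀'F₂)(F₃'F₁ + F₃F₁')`: the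
  -- last product cancels all mixed terms.
  have hmem := B.sub_mem (B.add_mem (B.mul_mem m01 m23) (B.mul_mem m03 m21)) (B.mul_mem m02 m31)
  rw [hcc, hcc] at hmem
  rw [hprod, hall.orbitSum_eq hw]
  refine B.smul_mem ?_ _
  rw [← inv_smul_smul₀ h2 (F 0 * F 1 * F 2 * F 3 + _)]
  refine B.smul_mem ?_ _
  convert hmem using 1
  rw [two_smul]
  simp only [map_mul]
  ring

theorem Multiset.exists_cons_four {α : Type*} {P : Multiset α} (hP : 5 ≤ Multiset.card P) :
    ∃ p₀ p₁ p₂ p₃ Q, P = p₀ ::ₘ p₁ ::ₘ p₂ ::ₘ p₃ ::ₘ Q ∧ Q ≠ 0 := by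
  have h : ∀ {Q : Multiset α} {k : ℕ}, k + 1 ≤ Multiset.card Q →
      ∃ p Q', Q = p ::ₘ Q' ∧ k ≤ Multiset.card Q' := by
    intro Q k hQ
    obtain ⟨p, hp⟩ := Multiset.card_pos_iff_exists_mem.mp (by omega : 0 < Multiset.card Q)
    obtain ⟨Q', rfl⟩ := Multiset.exists_cons_of_mem hp
    exact ⟨p, Q', rfl, by simpa using hQ⟩
  obtain ⟨p₀, Q₀, rfl, h₀⟩ := h hP
  obtain ⟨p₁, Q₁, rfl, h₁⟩ := h h₀
  obtain ⟨p₂, Q₂, rfl, h₂⟩ := h h₁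
  obtain ⟨p₃, Q₃, rfl, h₃⟩ := h h₂
  exact ⟨p₀, p₁, p₂, p₃, Q₃, rfl, Multiset.card_pos.mp h₃⟩

/-- The orbit sum of a product of at least ten linear weight vectors is decomposable. -/
theorem orbitSum_multiset_prod_mem (hw : IsPrimitiveRoot w 3) (h2 : (2 : K) ≠ 0)
    (h12 : (12 : K) ≠ 0) {B : Subalgebra K (MvPolynomial (Fin n) K)} {ι : Type*}
    {t : ι → ZMod 3} {k : ι → ZMod 2 × ZMod 2} {f : ι → MvPolynomial (Fin n) K}
    (hf : ∀ i, (f i).IsHomogeneous 1) (hwt : ∀ i, IsWeight ρ w (t i) (k i) (f i))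
    (s : Multiset ι) (hs : 10 ≤ Multiset.card s)
    (hB : ∀ e < Multiset.card s, ∀ f : MvPolynomial (Fin n) K, f.IsHomogeneous e →
      orbitSum ρ f ∈ B) :
    orbitSum ρ (s.map f).prod ∈ B := by
  have hprod := IsWeight.multiset_prod hw.pow_eq_one hwt
  have hdeg : ∀ s : Multiset ι, (s.map f).prod.IsHomogeneous (Multiset.card s) := by
    intro s
    induction s using Multiset.induction_on with
    | empty => simpa using isHomogeneous_one (Fin n) K
    | cons i s ih =>
      rw [Multiset.map_cons, Multiset.prod_cons, Multiset.card_cons, add_comm]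
      exact (hf i).mul ih
  by_cases hz : (s.map t).sum = 0 ∧ (s.map k).sum = 0
  swap
  · rw [(hprod s).orbitSum_eq_zero hw h2 hz]
    exact B.zero_mem
  obtain ⟨P, hPs, hP, hcard⟩ := Multiset.exists_zeroSum_partition k s hz.2
  -- From `10 ≤ 2 * card P + 1` there are at least five parts; degree 9 would guarantee only four.
  -- All parts after the fourth are merged into one.
  obtain ⟨p₀, p₁, p₂, p₃, Q, rfl, hQ⟩ := Multiset.exists_cons_four (P := P) (by omega)
  have hQ' : Q.sum ≠ 0 ∧ (Q.sum.map k).sum = 0 := by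
    have hQP : ∀ p ∈ Q, p ≠ 0 ∧ (p.map k).sum = 0 := fun p hp => hP p (by simp [hp])
    clear hPs hP hcard
    constructor
    · obtain ⟨p, hp⟩ := Multiset.exists_mem_of_ne_zero hQ
      obtain ⟨Q', rfl⟩ := Multiset.exists_cons_of_mem hp
      intro h
      rw [Multiset.sum_cons] at h
      exact (hQP p hp).1 (add_eq_zero.mp h).1
    · clear hQ
      induction Q using Multiset.induction_on with
      | empty => simp
      | cons p Q ih =>
        rw [Multiset.sum_cons, Multiset.map_add, Multiset.sum_add, (hQP p (by simp)).2,
          ih fun q hq => hQP q (by simp [hq]), add_zero]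
  let q : Fin 5 → Multiset ι := ![p₀, p₁, p₂, p₃, Q.sum]
  have hqs : ∑ i, q i = s := by
    rw [← hPs]
    simp [Fin.sum_univ_five, q, add_assoc]
  have hq : ∀ i, q i ≠ 0 ∧ ((q i).map k).sum = 0 := by
    intro i
    fin_cases i
    · exact hP p₀ (by simp)
    · exact hP p₁ (by simp)
    · exact hP p₂ (by simp)
    · exact hP p₃ (by simp)
    · exact hQ'
  have hfs : (s.map f).prod = ∏ i, ((q i).map f).prod := by
    rw [← hqs]; simp [Fin.sum_univ_five, Fin.prod_univ_five]
  rw [hfs]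
  refine orbitSum_prod_five_mem hw.pow_eq_one h2 h12 hB (fun i => hdeg (q i))
    (fun i => Multiset.card_pos.mpr (hq i).1) ?_ (t := fun i => ((q i).map t).sum)
    (fun i => ?_) ?_
  · rw [← hqs]; simp [Fin.sum_univ_five]
  · rw [← (hq i).2]; exact hprod (q i)
  · rw [← hz.1, ← hqs]; simp [Fin.sum_univ_five]

theorem orbitSum_mem_adjoin (hw : IsPrimitiveRoot w 3) (h2 : (2 : K) ≠ 0) (h3 : (3 : K) ≠ 0)
    (d : ℕ) (f : MvPolynomial (Fin n) K) (hf : f.IsHomogeneous d) :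
    orbitSum ρ f ∈ Algebra.adjoin K (invariantsLE ρ 9) := by
  induction d using Nat.strong_induction_on generalizing f with
  | _ d ih =>
  by_cases hd : d ≤ 9
  · exact Algebra.subset_adjoin
      ⟨orbitSum_mem ρ f, (orbitSum_isHomogeneous ρ hf).totalDegree_le.trans hd⟩
  have h12 : (12 : K) ≠ 0 := by
    rw [show (12 : K) = 2 * 2 * 3 by norm_num]
    exact mul_ne_zero (mul_ne_zero h2 h2) h3
  set S : Set (MvPolynomial (Fin n) K) := {f | f.IsHomogeneous 1 ∧ ∃ t k, IsWeight ρ w t k f}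
  -- Forms of degree `d` are the `d`-th power of the space of linear forms, which the linear weight
  -- vectors span.
  have hfS : f ∈ Submodule.span K (S ^ d) := by
    rw [← Submodule.span_pow]
    refine pow_le_pow_left' (homogeneousSubmodule_one_le_span_isWeight hw h2 h3) d ?_
    rwa [homogeneousSubmodule_one_pow]
  refine Submodule.span_induction (p := fun f _ => orbitSum ρ f ∈ _) ?_ (by simp) ?_ ?_ hfS
  · intro m hm
    obtain ⟨g, rfl⟩ := Set.mem_pow.mp hm
    choose t k htk using fun i => (g i).2.2
    have := orbitSum_multiset_prod_mem hw h2 h12 (ι := Fin d) (fun i => (g i).2.1) htk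
      Finset.univ.val (by simp; omega) (by simpa using ih)
    rwa [List.prod_ofFn]
  · intro x y _ _ hx hy
    rw [map_add]
    exact add_mem hx hy
  · intro c x _ hx
    rw [map_smul]
    exact Subalgebra.smul_mem _ hx c

theorem adjoin_invariantsLE_nine (hw : IsPrimitiveRoot w 3) (h2 : (2 : K) ≠ 0)
    (h3 : (3 : K) ≠ 0) : Algebra.adjoin K (invariantsLE ρ 9) = invariantAlgebra ρ := by
  refine le_antisymm (adjoin_invariantsLE_le ρ 9) fun f hf => ?_
  have h24 : (24 : K) ≠ 0 := by
    rw [show (24 : K) = 2 * 2 * 2 * 3 by norm_num]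
    exact mul_ne_zero (mul_ne_zero (mul_ne_zero h2 h2) h2) h3
  have hsum := orbitSum_of_mem ρ hf
  rw [card_C6C2C2] at hsum
  rw [← inv_smul_smul₀ h24 f]
  refine Subalgebra.smul_mem _ ?_ _
  have : orbitSum ρ f ∈ Algebra.adjoin K (invariantsLE ρ 9) := by
    rw [← sum_homogeneousComponent f, map_sum]
    exact sum_mem fun i _ => orbitSum_mem_adjoin hw h2 h3 i _ (homogeneousComponent_isHomogeneous i f)
  rw [hsum] at this
  exact_mod_cast this

end UpperBound

end InvariantTheory

/-! ### Lower bound: a three-dimensional module. -/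

namespace InvariantTheory

open MvPolynomial

section LowerBound

variable {K : Type*} [Field K] {z : K}

/-- The characters of `⟨a, b⟩` on the coordinates of a three-dimensional module. -/
noncomputable def coordChar (hz : z ^ 6 = 1) : Fin 3 → (Cyc 6 × Cyc 2 →* K) :=
  let χ : Cyc 6 × Cyc 2 →* K := (AddChar.zmodChar 6 hz).toMonoidHom.comp (MonoidHom.fst _ _)
  ![χ, χ.comp gammaAut.toMonoidHom,
    (AddChar.zmodChar 2 (neg_one_sq (R := K))).toMonoidHom.comp (MonoidHom.snd _ _)]

theorem gammaAut_gammaAut (x : Cyc 6 × Cyc 2) : gammaAut (gammaAut x) = x :=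
  gammaAut.left_inv x

/-- The matrix of `c`: it swaps the first two coordinates and changes the sign of the third. -/
def swapMatrix (K : Type*) [Field K] : Matrix (Fin 3) (Fin 3) K :=
  !![0, 1, 0; 1, 0, 0; 0, 0, -1]

theorem swapMatrix_mul_self : swapMatrix K * swapMatrix K = 1 := by
  ext i j
  fin_cases i <;> fin_cases j <;> simp [swapMatrix, Matrix.mul_apply, Fin.sum_univ_three]

theorem swapMatrix_conj_diagonal (x y u : K) :
    swapMatrix K * Matrix.diagonal ![x, y, u] = Matrix.diagonal ![y, x, u] * swapMatrix K := by
  ext i j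
  fin_cases i <;> fin_cases j <;>
    simp [swapMatrix, Matrix.mul_apply, Matrix.diagonal_apply]

/-- The diagonal matrices by which `⟨a, b⟩` acts. -/
noncomputable def diagHom (hz : z ^ 6 = 1) : Cyc 6 × Cyc 2 →* Matrix (Fin 3) (Fin 3) K :=
  (Matrix.diagonalRingHom (Fin 3) K).toMonoidHom.comp (MonoidHom.pi (coordChar hz))

theorem diagHom_apply (hz : z ^ 6 = 1) (x : Cyc 6 × Cyc 2) :
    diagHom hz x = Matrix.diagonal ![coordChar hz 0 x, coordChar hz 1 x, coordChar hz 2 x] := by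
  simp only [diagHom, MonoidHom.comp_apply]
  change Matrix.diagonal _ = _
  congr 1
  ext i
  fin_cases i <;> rfl

/-- The automorphism interchanges the first two characters and fixes the third, exactly as
conjugation by the matrix of `c` permutes diagonal entries. -/
theorem diagHom_gammaAut (hz : z ^ 6 = 1) (x : Cyc 6 × Cyc 2) :
    diagHom hz (gammaAut x) = swapMatrix K * diagHom hz x * swapMatrix K := by
  rw [diagHom_apply, diagHom_apply, swapMatrix_conj_diagonal, mul_assoc, swapMatrix_mul_self,
    mul_one]
  have h1 : coordChar hz 1 (gammaAut x) = coordChar hz 0 x :=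
    congrArg (coordChar hz 0) (gammaAut_gammaAut x)
  rw [h1]
  rfl

/-- The action of `⟨c⟩`. -/
def swapHom (K : Type*) [Field K] : Cyc 2 →* Matrix (Fin 3) (Fin 3) K where
  toFun s := swapMatrix K ^ (Multiplicative.toAdd s).val
  map_one' := by simp
  map_mul' s t := by
    rw [toAdd_mul, pow_val_add (by rw [pow_two, swapMatrix_mul_self])]

theorem diagHom_gammaHom (hz : z ^ 6 = 1) (s : Cyc 2) (x : Cyc 6 × Cyc 2) :
    diagHom hz (gammaHom s x) * swapHom K s = swapHom K s * diagHom hz x := by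
  have hs : ∀ s : Cyc 2, s = 1 ∨ s = Multiplicative.ofAdd 1 := by decide
  rcases hs s with rfl | rfl
  · simp
  · have h1 : gammaHom (Multiplicative.ofAdd 1) = gammaAut := pow_one _
    have h2 : swapHom K (Multiplicative.ofAdd 1) = swapMatrix K := pow_one _
    rw [h1, h2, diagHom_gammaAut, mul_assoc, swapMatrix_mul_self, mul_one]

/-- A three-dimensional matrix representation. -/
noncomputable def matrixHom (hz : z ^ 6 = 1) : C6C2C2 →* Matrix (Fin 3) (Fin 3) K where
  toFun g := diagHom hz g.left * swapHom K g.right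
  map_one' := by simp
  map_mul' g h := by
    rw [SemidirectProduct.mul_left, SemidirectProduct.mul_right, map_mul, map_mul, mul_assoc,
      ← mul_assoc (diagHom hz (gammaHom _ _)), diagHom_gammaHom]
    simp only [mul_assoc]

/-- The sum of a faithful two-dimensional module and a one-dimensional module. -/
noncomputable def threeDimRep (hz : z ^ 6 = 1) : Representation K C6C2C2 (Fin 3 → K) :=
  (Matrix.toLinAlgEquiv' (R := K) (n := Fin 3)).toAlgHom.toMonoidHom.comp (matrixHom hz)

theorem polyAct_threeDimRep_X (hz : z ^ 6 = 1) (g : C6C2C2) (j : Fin 3) :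
    polyAct (threeDimRep hz) g (X j) = ∑ i, C (matrixHom hz g⁻¹ j i) * X i := by
  have : LinearMap.toMatrix' (threeDimRep hz g⁻¹) = matrixHom hz g⁻¹ :=
    LinearMap.toMatrix'_toLin' _
  rw [polyAct, aeval_X, this]

theorem polyAct_threeDimRep_inl (hz : z ^ 6 = 1) (x : Cyc 6 × Cyc 2) (i j k : ℕ) :
    polyAct (threeDimRep hz) (SemidirectProduct.inl x) (X 0 ^ i * X 1 ^ j * X 2 ^ k) =
      (coordChar hz 0 x⁻¹ ^ i * coordChar hz 1 x⁻¹ ^ j * coordChar hz 2 x⁻¹ ^ k) •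
        (X 0 ^ i * X 1 ^ j * X 2 ^ k : MvPolynomial (Fin 3) K) := by
  have h : matrixHom hz (SemidirectProduct.inl x)⁻¹ = diagHom hz x⁻¹ := by
    rw [← map_inv]
    simp [matrixHom]
  simp only [map_mul, map_pow, polyAct_threeDimRep_X, h, diagHom_apply, Fin.sum_univ_three,
    Matrix.diagonal_apply, smul_eq_C_mul]
  simp
  ring

theorem polyAct_threeDimRep_elC (hz : z ^ 6 = 1) (i j k : ℕ) :
    polyAct (threeDimRep hz) elC (X 0 ^ i * X 1 ^ j * X 2 ^ k) =
      (X 1 ^ i * X 0 ^ j * (-X 2) ^ k : MvPolynomial (Fin 3) K) := by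
  have h : matrixHom hz elC⁻¹ = swapMatrix K := by
    rw [show elC⁻¹ = elC by decide]
    simp only [matrixHom, MonoidHom.coe_mk, OneHom.coe_mk, SemidirectProduct.left_inr, map_one,
      one_mul, SemidirectProduct.right_inr]
    exact pow_one _
  simp only [map_mul, map_pow, polyAct_threeDimRep_X, h, Fin.sum_univ_three]
  simp [swapMatrix]

/-- Polynomials are acted on through `a⁻¹`: the first character gives `z⁻¹ = z⁵`, and the second,
twisted by `a ↦ a⁻¹`, gives `z`. -/
theorem polyAct_threeDimRep_a (hz : z ^ 6 = 1) (i j k : ℕ) :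
    polyAct (threeDimRep hz) (SemidirectProduct.inl (Multiplicative.ofAdd 1, 1))
      (X 0 ^ i * X 1 ^ j * X 2 ^ k) =
      ((z ^ 5) ^ i * z ^ j) • (X 0 ^ i * X 1 ^ j * X 2 ^ k : MvPolynomial (Fin 3) K) := by
  rw [polyAct_threeDimRep_inl]
  have h0 : coordChar hz 0 (Multiplicative.ofAdd 1, 1)⁻¹ = z ^ 5 := rfl
  have h1 : coordChar hz 1 (Multiplicative.ofAdd 1, 1)⁻¹ = z := pow_one z
  have h2 : coordChar hz 2 (Multiplicative.ofAdd 1, 1)⁻¹ = 1 := pow_zero _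
  rw [h0, h1, h2, one_pow, mul_one]

theorem polyAct_threeDimRep_elB (hz : z ^ 6 = 1) (hz3 : z ^ 3 = -1) (i j k : ℕ) :
    polyAct (threeDimRep hz) elB (X 0 ^ i * X 1 ^ j * X 2 ^ k) =
      (-1 : K) ^ (j + k) • (X 0 ^ i * X 1 ^ j * X 2 ^ k : MvPolynomial (Fin 3) K) := by
  rw [polyAct_threeDimRep_inl]
  have h0 : coordChar hz 0 (1, Multiplicative.ofAdd 1)⁻¹ = 1 := pow_zero z
  have h1 : coordChar hz 1 (1, Multiplicative.ofAdd 1)⁻¹ = -1 := hz3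
  have h2 : coordChar hz 2 (1, Multiplicative.ofAdd 1)⁻¹ = -1 := pow_one _
  rw [h0, h1, h2, one_pow, one_mul, pow_add]

/-- The orbit sum of a monomial that is fixed by `⟨a, b⟩`. -/
theorem orbitSum_threeDimRep_monomial (hz : z ^ 6 = 1) (hz3 : z ^ 3 = -1) {i j k : ℕ}
    (ha : (z ^ 5) ^ i * z ^ j = 1) (hb : (-1 : K) ^ (j + k) = 1) :
    orbitSum (threeDimRep hz) (X 0 ^ i * X 1 ^ j * X 2 ^ k) =
      (12 : K) • (X 0 ^ i * X 1 ^ j * X 2 ^ k + X 1 ^ i * X 0 ^ j * (-X 2) ^ k) := by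
  have hA := polyAct_threeDimRep_a hz i j k
  rw [ha, one_smul] at hA
  -- For weight 0 the cube root of unity is immaterial, so 1 is used in its place.
  have hw : IsWeight (threeDimRep hz) 1 0 0 (X 0 ^ i * X 1 ^ j * X 2 ^ k) := by
    refine ⟨?_, ?_, ?_⟩
    · rw [show elA2 = SemidirectProduct.inl (Multiplicative.ofAdd 1, 1) *
        SemidirectProduct.inl (Multiplicative.ofAdd 1, 1) by decide, polyAct_mul_apply, hA, hA]
      simp
    · rw [show elA3 = SemidirectProduct.inl (Multiplicative.ofAdd 1, 1) *
        SemidirectProduct.inl (Multiplicative.ofAdd 1, 1) *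
        SemidirectProduct.inl (Multiplicative.ofAdd 1, 1) by decide, polyAct_mul_apply,
        polyAct_mul_apply, hA, hA, hA]
      simp
    · rw [polyAct_threeDimRep_elB hz hz3, hb]
      simp
  rw [hw.orbitSum_eq (one_pow 3), polyAct_threeDimRep_elC]

/-- Invariants of degree at most eight do not see the sign of the last coordinate. -/
theorem eval_orbitSum_threeDimRep_monomial (hz : IsPrimitiveRoot z 6) (hz3 : z ^ 3 = -1)
    (h2 : (2 : K) ≠ 0) (y : K) {i j k : ℕ} (hd : i + j + k ≤ 8) :
    eval ![1, y, 1] (orbitSum (threeDimRep hz.pow_eq_one) (X 0 ^ i * X 1 ^ j * X 2 ^ k)) =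
      eval ![1, y, -1]
        (orbitSum (threeDimRep hz.pow_eq_one) (X 0 ^ i * X 1 ^ j * X 2 ^ k)) := by
  by_cases ha : (z ^ 5) ^ i * z ^ j = 1
  swap
  · rw [orbitSum_eq_zero _ _ (polyAct_threeDimRep_a hz.pow_eq_one i j k) ha, map_zero, map_zero]
  by_cases hb : (-1 : K) ^ (j + k) = 1
  swap
  · rw [orbitSum_eq_zero _ _ (polyAct_threeDimRep_elB hz.pow_eq_one hz3 i j k) hb, map_zero,
      map_zero]
  rw [orbitSum_threeDimRep_monomial hz.pow_eq_one hz3 ha hb]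
  have h6 : 6 ∣ 5 * i + j := by
    rw [← hz.pow_eq_one_iff_dvd, pow_add, pow_mul, ha]
  rcases Nat.even_or_odd k with hk | hk
  · simp [hk.neg_pow]
  · have hjk : Even (j + k) := by
      by_contra hodd
      rw [Nat.not_even_iff_odd] at hodd
      rw [hodd.neg_one_pow] at hb
      apply h2
      linear_combination -hb
    -- Here `i ≡ j` modulo 6 with `j` and `k` odd. If `i ≠ j`, then `i + j ≥ 1 + 7` and `k ≥ 1`, so
    -- the degree is at least 9. For `i = j` and odd `k` the two terms of the orbit sum cancel.
    have hij : i = j := by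
      obtain ⟨l, hl⟩ := hk
      obtain ⟨r, hr⟩ := hjk
      obtain ⟨q, hq⟩ := h6
      omega
    subst hij
    simp [hk.neg_pow]

theorem eval_eq_of_mem_invariantsLE_eight (hz : IsPrimitiveRoot z 6) (hz3 : z ^ 3 = -1)
    (h2 : (2 : K) ≠ 0) (h24 : (24 : K) ≠ 0) (y : K) {f : MvPolynomial (Fin 3) K}
    (hf : f ∈ invariantsLE (threeDimRep hz.pow_eq_one) 8) :
    eval ![1, y, 1] f = eval ![1, y, -1] f := by
  have hsum := orbitSum_of_mem _ hf.1
  have key : eval ![1, y, 1] (orbitSum (threeDimRep hz.pow_eq_one) f) =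
      eval ![1, y, -1] (orbitSum (threeDimRep hz.pow_eq_one) f) := by
    conv_lhs => rw [f.as_sum]
    conv_rhs => rw [f.as_sum]
    simp only [map_sum]
    refine Finset.sum_congr rfl fun m hm => ?_
    have hdeg := (le_totalDegree hm).trans hf.2
    rw [Finsupp.sum_fintype _ _ (fun _ => rfl), Fin.sum_univ_three] at hdeg
    rw [monomial_eq, Finsupp.prod_fintype _ _ (fun _ => pow_zero _), Fin.prod_univ_three,
      ← smul_eq_C_mul, map_smul, smul_eval, smul_eval,
      eval_orbitSum_threeDimRep_monomial hz hz3 h2 y hdeg]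
  rw [hsum, card_C6C2C2, smul_eval, smul_eval] at key
  exact mul_left_cancel₀ (by exact_mod_cast h24) key

/-- An invariant of degree nine that sees the sign of the last coordinate. -/
theorem exists_invariant_eval_ne (hz : IsPrimitiveRoot z 6) (hz3 : z ^ 3 = -1)
    (h12 : (12 : K) ≠ 0) (h2 : (2 : K) ≠ 0) {y : K} (hy : y ≠ 0) (hy6 : y ^ 6 = -1) :
    ∃ f ∈ invariantAlgebra (threeDimRep hz.pow_eq_one),
      eval ![1, y, 1] f ≠ eval ![1, y, -1] f := by
  -- The smallest exponents with `i ≠ j` allowed above. The orbit sum is `12x₀x₁x₂(x₀⁶ - x₁⁶)`, and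
  -- its values at the two points differ by `24y(1 - y⁶) = 48y`.
  refine ⟨_, orbitSum_mem _ (X 0 ^ 7 * X 1 ^ 1 * X 2 ^ 1), ?_⟩
  rw [orbitSum_threeDimRep_monomial hz.pow_eq_one hz3
    (by rw [← pow_mul, ← pow_add, hz.pow_eq_one_iff_dvd]; norm_num) (by norm_num)]
  intro h
  have h' : (12 * 2 * 2 * y : K) = 0 := by
    simp at h
    linear_combination (24 * y) * hy6 + h
  simp [h12, h2, hy] at h'

theorem eval_apply_of_mem {G : Type*} [Group G] {n : ℕ} (ρ : Representation K G (Fin n → K))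
    {f : MvPolynomial (Fin n) K} (hf : f ∈ invariantAlgebra ρ) (g : G) (v : Fin n → K) :
    eval (ρ g v) f = eval v f := by
  have := eval_polyAct ρ g⁻¹ v f
  rw [inv_inv, (mem_invariantAlgebra ρ).mp hf] at this
  exact this.symm

theorem orbit_ne_of_eval_ne {G : Type*} [Group G] {n : ℕ} (ρ : Representation K G (Fin n → K))
    {f : MvPolynomial (Fin n) K} (hf : f ∈ invariantAlgebra ρ) {v w : Fin n → K}
    (h : eval v f ≠ eval w f) : orbit ρ v ≠ orbit ρ w := by
  intro horb
  have hv : v ∈ orbit ρ v := ⟨1, by simp⟩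
  rw [horb] at hv
  obtain ⟨g, rfl⟩ := hv
  exact h (eval_apply_of_mem ρ hf g w)

/-- Agreement of low-degree invariants at the two points passes to the algebra they generate, so the
degree 9 invariant is neither replaced in separating nor generated below degree 9. -/
theorem nine_le_numbers (hz : IsPrimitiveRoot z 6) (hz3 : z ^ 3 = -1)
    (h2 : (2 : K) ≠ 0) (h3 : (3 : K) ≠ 0) {y : K} (hy : y ≠ 0) (hy6 : y ^ 6 = -1) :
    9 ≤ sepNoetherNumberOf (threeDimRep hz.pow_eq_one) ∧
      9 ≤ noetherNumberOf (threeDimRep hz.pow_eq_one) := by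
  have h12 : (12 : K) ≠ 0 := by
    rw [show (12 : K) = 2 * 2 * 3 by norm_num]
    exact mul_ne_zero (mul_ne_zero h2 h2) h3
  have h24 : (24 : K) ≠ 0 := by
    rw [show (24 : K) = 2 * 12 by norm_num]
    exact mul_ne_zero h2 h12
  obtain ⟨f, hf, hne⟩ := exists_invariant_eval_ne hz hz3 h12 h2 hy hy6
  have hlow : ∀ d < 9, ∀ p ∈ invariantsLE (threeDimRep hz.pow_eq_one) d,
      eval ![1, y, 1] p = eval ![1, y, -1] p := fun d hd p hp =>
    eval_eq_of_mem_invariantsLE_eight hz hz3 h2 h24 y ⟨hp.1, hp.2.trans (by omega)⟩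
  have hcast : ∀ d : ℕ, ¬ d < 9 → (9 : ℕ∞) ≤ d := fun d hd => by exact_mod_cast not_lt.mp hd
  constructor
  · refine le_iInf₂ fun d hd => hcast d fun hlt => ?_
    obtain ⟨p, hp, hpne⟩ := hd.2 _ _ (orbit_ne_of_eval_ne _ hf hne)
    exact hpne (hlow d hlt p hp)
  · refine le_iInf₂ fun d hd => hcast d fun hlt => ?_
    rw [← hd.2] at hf
    exact hne (eval_eq_of_mem_adjoin (hlow d hlt) hf)

end LowerBound

end InvariantTheory

theorem mainTheorem8 {K : Type*} [Field K] (hK : ∃ ξ : K, orderOf ξ = 12) :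
    InvariantTheory.sepNoetherNumber K C6C2C2 = 9 ∧
      InvariantTheory.noetherNumber K C6C2C2 = 9 := by
  obtain ⟨y, hy⟩ := hK
  have hyp : IsPrimitiveRoot y 12 := hy ▸ IsPrimitiveRoot.orderOf y
  have hz : IsPrimitiveRoot (y ^ 2) 6 := hyp.pow (by norm_num) (by norm_num)
  have hw : IsPrimitiveRoot (y ^ 4) 3 := hyp.pow (by norm_num) (by norm_num)
  have h6 : IsPrimitiveRoot (y ^ 6) 2 := hyp.pow (by norm_num) (by norm_num)
  have hy6 : y ^ 6 = -1 := h6.eq_neg_one_of_two_right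
  have hz3 : (y ^ 2) ^ 3 = -1 := by rw [← pow_mul, hy6]
  have h2 : (2 : K) ≠ 0 := by
    intro h
    apply h6.ne_one (by norm_num)
    rw [hy6]
    linear_combination -h
  have h3 : (3 : K) ≠ 0 := by
    intro h
    -- If 3 = 0, then `(u - 1)³ = u³ - 1`, so 1 is the only cube root of unity.
    have h1 : (y ^ 4 - 1) ^ 3 = 0 := by
      linear_combination hw.pow_eq_one + (y ^ 4 - y ^ 8) * h
    exact hw.ne_one (by norm_num) (sub_eq_zero.mp (pow_eq_zero_iff (by norm_num) |>.mp h1))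
  obtain ⟨hs, hn⟩ := InvariantTheory.nine_le_numbers hz hz3 h2 h3
    (hyp.ne_zero (by norm_num)) hy6
  have hup : ∀ (n : ℕ) (ρ : Representation K C6C2C2 (Fin n → K)),
      Algebra.adjoin K (InvariantTheory.invariantsLE ρ 9) =
        InvariantTheory.invariantAlgebra ρ :=
    fun n ρ => InvariantTheory.adjoin_invariantsLE_nine hw h2 h3
  refine ⟨le_antisymm (iSup₂_le fun n ρ => ?_) (le_iSup₂_of_le 3 _ hs),
    le_antisymm (iSup₂_le fun n ρ => ?_) (le_iSup₂_of_le 3 _ hn)⟩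
  · exact iInf₂_le 9 ⟨by norm_num, InvariantTheory.isSeparating_of_adjoin_eq ρ (hup n ρ)⟩
  · exact iInf₂_le 9 ⟨by norm_num, hup n ρ⟩
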